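/- Let $d\in\mathbb N$, let $\gamma$ be the standard Gaussian measure on $\mathbb R^d$, and let $1\le q<\infty$. Let $W^{q,1}(\gamma)$ be the class of functions $f\in L^q(\gamma)$ that possess a generalized (distributional) gradient $\nabla f$ with $|\nabla f|\in L^q(\gamma)$. Let $f\in W^{q,1}(\gamma)$ be a probability density with respect to $\gamma$, that is, $f\ge 0$ $\gamma$-a.e. and $\int f\,d\gamma=1$, and let $f\gamma$ denote the probability measure with density $f$ with respect to $\gamma$. Then for every real $u\ge 8$ $$ \gamma(f\ge 2u)\;\le\;\inf_{t>0}\left[\frac{K_q^q\,\arccos^q(e^{-t})}{u^q}\,\|\nabla f\|_{q}^{q}+\frac{2}{(e^{2t}-1)\,u\ln u}\,W_2^2(f\gamma,\gamma)\right], $$ where $\|\nabla f\|_q$ is the $L^q(\gamma)$-norm of $|\nabla f|$, $$ K_q^q=\frac1{\sqrt{2\pi}}\int_{\mathbb R}|x|^q e^{-x^2/2}\,dx, $$ and $W_2$ is the Kantorovich distance of order $2$, with values in $[0,\infty]$: $$ W_2(\mu,\nu)^2=\inf_{\sigma\in\Pi(\mu,\nu)}\int_{\mathbb R^d\times\mathbb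 R^d}|x-y|^2\,\sigma(dx\,dy), $$ $\Pi(\mu,\nu)$ being the set of Borel probability measures on $\mathbb R^d\times\mathbb R^d$ with projections $\mu$ and $\nu$ onto the first and second factors. -/

import Mathlib

open MeasureTheory ProbabilityTheory
open scoped ENNReal ContDiff

/-- The standard Gaussian measure `γ` on `ℝ^d`. -/
noncomputable abbrev gaussianMeasure (d : ℕ) : Measure (EuclideanSpace ℝ (Fin d)) :=
  stdGaussian (EuclideanSpace ℝ (Fin d))

/-- `g` is a generalized (weak, distributional) gradient of `f` on `ℝ^d`: both are locally
integrable with respect to Lebesgue measure, and the integration by parts formula holds in every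
direction against every smooth compactly supported test function. -/
structure HasGeneralizedGradient {d : ℕ} (f : EuclideanSpace ℝ (Fin d) → ℝ)
    (g : EuclideanSpace ℝ (Fin d) → EuclideanSpace ℝ (Fin d)) : Prop where
  locallyIntegrable_fun : LocallyIntegrable f volume
  locallyIntegrable_grad : LocallyIntegrable g volume
  integral_by_parts : ∀ φ : EuclideanSpace ℝ (Fin d) → ℝ, ContDiff ℝ ∞ φ → HasCompactSupport φ →
    ∀ v : EuclideanSpace ℝ (Fin d),
      ∫ x, f x * fderiv ℝ φ x v = -∫ x, inner ℝ (g x) v * φ x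

/-- The weighted Sobolev class `W^{q,1}(γ)`: functions `f ∈ L^q(γ)` that possess a generalized
gradient whose norm is in `L^q(γ)`. -/
def MemGaussianSobolev {d : ℕ} (q : ℝ) (f : EuclideanSpace ℝ (Fin d) → ℝ) : Prop :=
  MemLp f (ENNReal.ofReal q) (gaussianMeasure d) ∧
    ∃ g : EuclideanSpace ℝ (Fin d) → EuclideanSpace ℝ (Fin d),
      HasGeneralizedGradient f g ∧ MemLp g (ENNReal.ofReal q) (gaussianMeasure d)

/-- The measure `fγ` with density `f` with respect to `γ`. -/
noncomputable def gaussianWithDensity {d : ℕ} (f : EuclideanSpace ℝ (Fin d) → ℝ) :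
    Measure (EuclideanSpace ℝ (Fin d)) :=
  (gaussianMeasure d).withDensity fun x => ENNReal.ofReal (f x)

/-- `Π(μ, ν)`: the measures on `E × E` with projections `μ` and `ν` on the factors. -/
def couplings {E : Type*} [MeasurableSpace E] (μ ν : Measure E) : Set (Measure (E × E)) :=
  {σ | σ.map Prod.fst = μ ∧ σ.map Prod.snd = ν}

/-- The Kantorovich distance `W_p` of order `p`, with values in `[0, ∞]`. -/
noncomputable def kantorovichDist {E : Type*} [PseudoEMetricSpace E] [MeasurableSpace E]
    (p : ℝ) (μ ν : Measure E) : ℝ≥0∞ :=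
  (⨅ σ ∈ couplings μ ν, ∫⁻ z, edist z.1 z.2 ^ p ∂σ) ^ (1 / p)

/-- `K_q^q`, the absolute moment of order `q` of the standard normal law on the line. -/
noncomputable def gaussianAbsMoment (q : ℝ) : ℝ :=
  1 / √(2 * Real.pi) * ∫ x : ℝ, |x| ^ q * Real.exp (-x ^ 2 / 2)

/-!
Let `γ` be the standard Gaussian measure and let `x`, `y` be independent with law `γ`. The pair
`(cos θ • x + sin θ • y, -sin θ • x + cos θ • y)` has the same law as `(x, y)`, and for
`cos θ = exp (-t)` averaging `f (cos θ • x + sin θ • y)` over `y` gives the Ornstein-Uhlenbeck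
semigroup `T_t f (x)` (`mehler`). If `f x ≥ 2 * u`, then either the mean of
`|f x - f (cos θ • x + sin θ • y)|` over `y` is at least `u`, or `T_t f (x) ≥ u`
(`gaussianMeasure_two_mul_le_le_add`). The two alternatives give the two terms of the bound.

The increment is the integral over `s ∈ [0, θ]` of the gradient of `f` at `cos s • x + sin s • y`,
tested against the second component of the rotated pair. By Jensen's inequality and the rotation
invariance its `L^q` norm is at most `θ` times that of `⟪∇f x, y⟫`, which is `K_q ‖∇f‖_q` because
`⟪a, y⟫` is a centered normal variable with variance `‖a‖²`. Chebyshev's inequality then applies.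
For a generalized gradient (`HasGeneralizedGradient.lintegral_enorm_sub_rotation_le`) one uses
mollifications. They converge almost everywhere, and on balls they increase the Gaussian `L^q` norm
of the gradient by a factor tending to `1`, so Fatou's lemma suffices.

For the semigroup, the transition probabilities from `x` and `y` are translates of one Gaussian
measure, with relative entropy `‖x - y‖² / (2 (exp (2t) - 1))`. The entropy inequality with the test
function `log u` on `A = {T_t f ≥ u}` and `0` elsewhere, integrated over a coupling of `f γ` and `γ`,
gives `(u log u - u + 1) γ(A) ≤ W₂² / (2 (exp (2t) - 1))` (`gaussianMeasure_le_mehler_le`). For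
`u ≥ 8` one has `log u ≥ 2`, so the factor on the left is at least `u log u / 2`.

Both parts rest on the Cameron-Martin formula `gaussianMeasure_map_add_const`, which also yields the
absolute continuity of `γ` with respect to Lebesgue measure.
-/

/-! ### Moments and translations of the standard Gaussian measure -/

lemma gaussianMeasure_map_inner {d : ℕ} (a : EuclideanSpace ℝ (Fin d)) :
    (gaussianMeasure d).map (fun x => inner ℝ a x) = gaussianReal 0 (‖a‖ ^ 2).toNNReal := by
  have h := IsGaussian.map_eq_gaussianReal (μ := gaussianMeasure d) (innerSL ℝ a)
  rw [integral_strongDual_stdGaussian, variance_dual_stdGaussian, innerSL_apply_norm] at h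
  exact h

lemma lintegral_enorm_inner_rpow {d : ℕ} {q : ℝ} (hq : 1 ≤ q) (a : EuclideanSpace ℝ (Fin d)) :
    ∫⁻ y, ‖inner ℝ a y‖ₑ ^ q ∂(gaussianMeasure d) =
      ENNReal.ofReal (gaussianAbsMoment q) * ‖a‖ₑ ^ q := by
  have hq0 : 0 ≤ q := by linarith
  have h1 : ∫⁻ y, ‖inner ℝ a y‖ₑ ^ q ∂(gaussianMeasure d) =
      ∫⁻ s : ℝ, ‖s‖ₑ ^ q ∂(gaussianReal 0 (‖a‖ ^ 2).toNNReal) := by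
    rw [← gaussianMeasure_map_inner, lintegral_map (by fun_prop) (by fun_prop)]
  have h2 : gaussianReal 0 (‖a‖ ^ 2).toNNReal = (gaussianReal 0 1).map (fun s => ‖a‖ * s) := by
    rw [gaussianReal_map_const_mul]
    congr 1
    · simp
    · ext; simp
  have h3 : ∫⁻ s : ℝ, ‖s‖ₑ ^ q ∂(gaussianReal 0 1) = ENNReal.ofReal (gaussianAbsMoment q) := by
    have hint : Integrable (fun x : ℝ => |x| ^ q * Real.exp (-x ^ 2 / 2)) := by
      have h := (memLp_id_gaussianReal' (μ := 0) (v := 1) (ENNReal.ofReal q)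
        ENNReal.ofReal_ne_top).integrable_norm_rpow (by simpa using by linarith)
        ENNReal.ofReal_ne_top
      rw [gaussianReal_of_var_ne_zero _ one_ne_zero, ENNReal.toReal_ofReal hq0,
        integrable_withDensity_iff_integrable_smul' (measurable_gaussianPDF 0 1)
          (ae_of_all _ fun _ => gaussianPDF_lt_top)] at h
      refine (h.const_mul √(2 * Real.pi)).congr (ae_of_all _ fun x => ?_)
      have : √(2 * Real.pi) ≠ 0 := by positivity
      simp [toReal_gaussianPDF, gaussianPDFReal]
      field_simp
    rw [gaussianReal_of_var_ne_zero _ one_ne_zero,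
      lintegral_withDensity_eq_lintegral_mul _ (measurable_gaussianPDF 0 1) (by fun_prop),
      gaussianAbsMoment, ← integral_const_mul,
      ofReal_integral_eq_lintegral_ofReal (hint.const_mul _) (ae_of_all _ fun x => by positivity)]
    refine lintegral_congr fun x => ?_
    simp only [Pi.mul_apply, gaussianPDF, gaussianPDFReal]
    rw [← ofReal_norm, ENNReal.ofReal_rpow_of_nonneg (norm_nonneg _) hq0,
      ← ENNReal.ofReal_mul (by positivity), Real.norm_eq_abs]
    congr 1
    simp
    ring
  rw [h1, h2, lintegral_map (by fun_prop) (by fun_prop), ← h3, mul_comm,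
    ← lintegral_const_mul _ (by fun_prop)]
  refine lintegral_congr fun s => ?_
  rw [enorm_mul, ENNReal.mul_rpow_of_nonneg _ _ hq0, enorm_norm]

lemma integrable_exp_inner {d : ℕ} (w : EuclideanSpace ℝ (Fin d)) :
    Integrable (fun x => Real.exp (inner ℝ w x - ‖w‖ ^ 2 / 2)) (gaussianMeasure d) := by
  have h := integrable_exp_mul_gaussianReal (μ := 0) (v := (‖w‖ ^ 2).toNNReal) 1
  rw [← gaussianMeasure_map_inner, integrable_map_measure (by fun_prop) (by fun_prop)] at h
  refine (h.mul_const (Real.exp (-(‖w‖ ^ 2 / 2)))).congr (ae_of_all _ fun x => ?_)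
  simp [← Real.exp_add, sub_eq_add_neg]

/-- The complex Laplace transform of the standard Gaussian measure. -/
lemma integral_cexp_gaussianMeasure {d : ℕ} (w t : EuclideanSpace ℝ (Fin d)) :
    ∫ x, Complex.exp ((inner ℝ w x : ℝ) + (inner ℝ x t : ℝ) * Complex.I) ∂(gaussianMeasure d) =
      Complex.exp ((‖w‖ ^ 2 - ‖t‖ ^ 2) / 2 + (inner ℝ w t : ℝ) * Complex.I) := by
  rw [gaussianMeasure, ← map_pi_eq_stdGaussian, integral_map (by fun_prop) (by fun_prop)]
  have h1 : ∀ x : Fin d → ℝ,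
      Complex.exp ((inner ℝ w (WithLp.toLp 2 x) : ℝ) +
        (inner ℝ (WithLp.toLp 2 x) t : ℝ) * Complex.I) =
      ∏ i, Complex.exp ((w i + t i * Complex.I) * x i) := by
    intro x
    rw [← Complex.exp_sum]
    congr 1
    simp only [PiLp.inner_apply, RCLike.inner_apply, conj_trivial, Complex.ofReal_sum,
      Complex.ofReal_mul, Finset.sum_mul, ← Finset.sum_add_distrib]
    refine Finset.sum_congr rfl fun i _ => ?_
    ring
  simp_rw [h1]
  rw [integral_fintype_prod_eq_prod (f := fun i (s : ℝ) => Complex.exp ((w i + t i * Complex.I) * s))]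
  have h2 : ∀ z : ℂ, ∫ s : ℝ, Complex.exp (z * s) ∂(gaussianReal 0 1) = Complex.exp (z ^ 2 / 2) := by
    intro z
    have := complexMGF_id_gaussianReal (μ := 0) (v := 1) z
    simpa [complexMGF] using this
  simp_rw [h2]
  rw [← Complex.exp_sum]
  congr 1
  rw [← Complex.ofReal_pow, ← Complex.ofReal_pow, EuclideanSpace.real_norm_sq_eq,
    EuclideanSpace.real_norm_sq_eq]
  simp only [PiLp.inner_apply, RCLike.inner_apply, conj_trivial, Complex.ofReal_sum,
      Complex.ofReal_mul, Finset.sum_mul, ← Finset.sum_add_distrib, ← Finset.sum_sub_distrib,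
      Finset.sum_div, Complex.ofReal_pow]
  refine Finset.sum_congr rfl fun i _ => ?_
  linear_combination (t i : ℂ) ^ 2 / 2 * Complex.I_sq

/-- **Cameron-Martin formula**: the translate of `γ` by `w` has density
`exp (⟪w, x⟫ - ‖w‖² / 2)` with respect to `γ`. -/
theorem gaussianMeasure_map_add_const {d : ℕ} (w : EuclideanSpace ℝ (Fin d)) :
    (gaussianMeasure d).map (fun x => x + w) = (gaussianMeasure d).withDensity
      (fun x => ENNReal.ofReal (Real.exp (inner ℝ w x - ‖w‖ ^ 2 / 2))) := by
  have : IsFiniteMeasure ((gaussianMeasure d).withDensity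
      (fun x => ENNReal.ofReal (Real.exp (inner ℝ w x - ‖w‖ ^ 2 / 2)))) :=
    isFiniteMeasure_withDensity_ofReal (integrable_exp_inner w).2
  apply Measure.ext_of_charFun
  ext t
  rw [charFun_map_add_const, charFun_stdGaussian, charFun_apply,
    integral_withDensity_eq_integral_toReal_smul (by fun_prop) (by simp)]
  have h1 : ∀ x : EuclideanSpace ℝ (Fin d),
      (ENNReal.ofReal (Real.exp (inner ℝ w x - ‖w‖ ^ 2 / 2))).toReal •
        Complex.exp ((inner ℝ x t : ℝ) * Complex.I) = Complex.exp (-(‖w‖ ^ 2 / 2)) *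
        Complex.exp ((inner ℝ w x : ℝ) + (inner ℝ x t : ℝ) * Complex.I) := by
    intro x
    rw [ENNReal.toReal_ofReal (Real.exp_pos _).le, Complex.real_smul, Complex.ofReal_exp,
      ← Complex.exp_add, ← Complex.exp_add]
    congr 1
    push_cast
    ring
  simp_rw [h1]
  rw [integral_const_mul, integral_cexp_gaussianMeasure, ← Complex.exp_add, ← Complex.exp_add]
  congr 1
  ring

/-- By Tonelli's theorem almost every translate of a Lebesgue null set is `γ`-null, and the
Cameron-Martin formula moves this to the set itself. -/
theorem gaussianMeasure_absolutelyContinuous (d : ℕ) :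
    gaussianMeasure d ≪ (volume : Measure (EuclideanSpace ℝ (Fin d))) := by
  refine Measure.AbsolutelyContinuous.mk fun s hs h0 => ?_
  have h1 : ∫⁻ w, ((gaussianMeasure d).map (fun x => x + w)) s = 0 := by
    have : ∀ w, ((gaussianMeasure d).map (fun x => x + w)) s =
        ∫⁻ x, s.indicator 1 (x + w) ∂(gaussianMeasure d) := by
      intro w
      rw [← lintegral_indicator_one hs, lintegral_map (measurable_one.indicator hs) (by fun_prop)]
    simp_rw [this]
    have hm : Measurable fun p : EuclideanSpace ℝ (Fin d) × EuclideanSpace ℝ (Fin d) =>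
        s.indicator (1 : EuclideanSpace ℝ (Fin d) → ℝ≥0∞) (p.2 + p.1) :=
      (measurable_one.indicator hs).comp (measurable_snd.add measurable_fst)
    rw [lintegral_lintegral_swap hm.aemeasurable]
    simp_rw [lintegral_add_left_eq_self (μ := volume)
      (s.indicator (1 : EuclideanSpace ℝ (Fin d) → ℝ≥0∞)),
      lintegral_indicator_one hs, h0]
    simp
  have h2 : ∃ w, ((gaussianMeasure d).map (fun x => x + w)) s = 0 := by
    by_contra! hne
    have hm : Measurable fun w => ((gaussianMeasure d).map (fun x => x + w)) s := by
      have : (fun w => ((gaussianMeasure d).map (fun x => x + w)) s) =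
          fun w => gaussianMeasure d ((fun x => (w, x)) ⁻¹' ((fun p => p.2 + p.1) ⁻¹' s)) := by
        ext w
        rw [Measure.map_apply (by fun_prop) hs]
        rfl
      rw [this]
      exact measurable_measure_prodMk_left
        ((measurable_snd.add measurable_fst) hs)
    rw [lintegral_eq_zero_iff hm] at h1
    obtain ⟨w, hw⟩ := h1.exists
    exact hne w hw
  obtain ⟨w, hw⟩ := h2
  rw [gaussianMeasure_map_add_const, withDensity_apply_eq_zero (by fun_prop)] at hw
  convert hw using 2
  ext x
  simp [Real.exp_pos]

/-! ### Rotation invariance and Jensen's inequality -/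

lemma measurePreserving_rotation (d : ℕ) (θ : ℝ) :
    MeasurePreserving (ContinuousLinearMap.rotation (E := EuclideanSpace ℝ (Fin d)) θ)
      ((gaussianMeasure d).prod (gaussianMeasure d))
      ((gaussianMeasure d).prod (gaussianMeasure d)) :=
  ⟨by fun_prop, IsGaussian.map_rotation_eq_self (by simp) θ⟩

/-- Jensen's inequality for a measure that need not be normalized. -/
lemma lintegral_rpow_le_measure_univ_mul {α : Type*} [MeasurableSpace α] (μ : Measure α)
    {h : α → ℝ≥0∞} (hh : AEMeasurable h μ) {q : ℝ} (hq : 1 ≤ q) :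
    (∫⁻ x, h x ∂μ) ^ q ≤ μ Set.univ ^ (q - 1) * ∫⁻ x, h x ^ q ∂μ := by
  have hq0 : 0 < q := by linarith
  have := eLpNorm'_le_eLpNorm'_mul_rpow_measure_univ (μ := μ) (f := h) one_pos hq
    hh.aestronglyMeasurable
  simp only [eLpNorm', enorm_eq_self, ENNReal.rpow_one, div_one] at this
  calc _ ≤ _ := ENNReal.rpow_le_rpow this hq0.le
    _ = _ := by
      rw [ENNReal.mul_rpow_of_nonneg _ _ hq0.le, ← ENNReal.rpow_mul, ← ENNReal.rpow_mul, mul_comm]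
      congr 2
      · field_simp
      · rw [one_div_mul_cancel hq0.ne', ENNReal.rpow_one]

/-! ### Increments along rotations -/

/-- The rotation of `E × E` preserves `‖x‖² + ‖y‖²`. -/
lemma norm_sq_rotation {E : Type*} [NormedAddCommGroup E] [InnerProductSpace ℝ E] (θ : ℝ)
    (p : E × E) :
    ‖(ContinuousLinearMap.rotation θ p).1‖ ^ 2 + ‖(ContinuousLinearMap.rotation θ p).2‖ ^ 2 =
      ‖p.1‖ ^ 2 + ‖p.2‖ ^ 2 := by
  rw [ContinuousLinearMap.rotation_apply]
  simp only [← real_inner_self_eq_norm_sq, inner_add_left, inner_add_right, real_inner_smul_left,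
    real_inner_smul_right, real_inner_comm p.1 p.2]
  linear_combination (inner ℝ p.1 p.1 + inner ℝ p.2 p.2) * Real.sin_sq_add_cos_sq θ

/-- Along the circle `s ↦ cos s • x + sin s • y` the velocity is the second component of the
rotated pair. -/
lemma enorm_sub_rotation_le {E : Type*} [NormedAddCommGroup E] [NormedSpace ℝ E]
    {F : E → ℝ} (hF : ContDiff ℝ 1 F) {θ : ℝ} (hθ : 0 ≤ θ) (p : E × E) :
    ‖F p.1 - F (ContinuousLinearMap.rotation θ p).1‖ₑ ≤
      ∫⁻ s in Set.Ioc 0 θ, ‖fderiv ℝ F (ContinuousLinearMap.rotation s p).1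
        (ContinuousLinearMap.rotation s p).2‖ₑ := by
  have hd : ∀ s : ℝ, HasDerivAt (fun s => F (ContinuousLinearMap.rotation s p).1)
      (fderiv ℝ F (ContinuousLinearMap.rotation s p).1
        (ContinuousLinearMap.rotation s p).2) s := by
    intro s
    have h1 : HasDerivAt (fun s => (ContinuousLinearMap.rotation s p).1)
        (ContinuousLinearMap.rotation s p).2 s := by
      simp only [ContinuousLinearMap.rotation_apply]
      exact ((Real.hasDerivAt_cos s).smul_const p.1).add ((Real.hasDerivAt_sin s).smul_const p.2)
    exact ((hF.differentiable one_ne_zero _).hasFDerivAt).comp_hasDerivAt s h1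
  have hc : Continuous fun s => fderiv ℝ F (ContinuousLinearMap.rotation s p).1
        (ContinuousLinearMap.rotation s p).2 := by
    have := hF.continuous_fderiv one_ne_zero
    simp only [ContinuousLinearMap.rotation_apply]
    fun_prop
  have h := intervalIntegral.integral_eq_sub_of_hasDerivAt (fun s _ => hd s)
    (hc.intervalIntegrable 0 θ)
  have h0 : (ContinuousLinearMap.rotation 0 p).1 = p.1 := by
    simp [ContinuousLinearMap.rotation_apply]
  rw [h0] at h
  rw [← enorm_neg, neg_sub, ← h, intervalIntegral.integral_of_le hθ]
  exact enorm_integral_le_lintegral_enorm _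

/-- Gaussian estimate of the increment of a `C¹` function over a rotation, on a rotation-invariant
ball of the product space. -/
lemma setLIntegral_enorm_sub_rotation_le {d : ℕ} {q : ℝ} (hq : 1 ≤ q)
    {F : EuclideanSpace ℝ (Fin d) → ℝ} (hF : ContDiff ℝ 1 F)
    {G : EuclideanSpace ℝ (Fin d) → EuclideanSpace ℝ (Fin d)}
    (hG : ∀ x v, fderiv ℝ F x v = inner ℝ (G x) v) {θ : ℝ} (hθ : 0 ≤ θ) {R : ℝ} (hR : 0 ≤ R) :
    ∫⁻ p in {p | ‖p.1‖ ^ 2 + ‖p.2‖ ^ 2 ≤ R ^ 2},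
        ‖F p.1 - F (ContinuousLinearMap.rotation θ p).1‖ₑ ^ q
          ∂((gaussianMeasure d).prod (gaussianMeasure d)) ≤
      ENNReal.ofReal (gaussianAbsMoment q * θ ^ q) *
        ∫⁻ x in Metric.closedBall 0 R, ‖G x‖ₑ ^ q ∂(gaussianMeasure d) := by
  have hq0 : 0 ≤ q := by linarith
  set γ := gaussianMeasure d
  set S : Set (EuclideanSpace ℝ (Fin d) × EuclideanSpace ℝ (Fin d)) :=
    {p | ‖p.1‖ ^ 2 + ‖p.2‖ ^ 2 ≤ R ^ 2}
  have hS : MeasurableSet S := measurableSet_le (by fun_prop) (by fun_prop)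
  set H : EuclideanSpace ℝ (Fin d) × EuclideanSpace ℝ (Fin d) → ℝ≥0∞ :=
    fun p => ‖fderiv ℝ F p.1 p.2‖ₑ ^ q
  have hF' := hF.continuous_fderiv one_ne_zero
  have hH : Measurable H := by
    have : Continuous fun p : EuclideanSpace ℝ (Fin d) × EuclideanSpace ℝ (Fin d) =>
      fderiv ℝ F p.1 p.2 := by fun_prop
    exact this.measurable.enorm.pow_const q
  have hrot : Measurable fun z : (EuclideanSpace ℝ (Fin d) × EuclideanSpace ℝ (Fin d)) × ℝ =>
      ContinuousLinearMap.rotation z.2 z.1 := by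
    simp only [ContinuousLinearMap.rotation_apply]
    fun_prop
  have hmemS : ∀ s p, ContinuousLinearMap.rotation s p ∈ S ↔ p ∈ S := by
    intro s p
    simp only [S, Set.mem_ofPred_eq, norm_sq_rotation]
  have hpt : ∀ p, ‖F p.1 - F (ContinuousLinearMap.rotation θ p).1‖ₑ ^ q ≤
      ENNReal.ofReal θ ^ (q - 1) *
        ∫⁻ s in Set.Ioc 0 θ, H (ContinuousLinearMap.rotation s p) := by
    intro p
    have hm : Measurable fun s => ‖fderiv ℝ F (ContinuousLinearMap.rotation s p).1
        (ContinuousLinearMap.rotation s p).2‖ₑ := by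
      have : Continuous fun s => fderiv ℝ F (ContinuousLinearMap.rotation s p).1
        (ContinuousLinearMap.rotation s p).2 := by
        simp only [ContinuousLinearMap.rotation_apply]
        fun_prop
      exact this.measurable.enorm
    calc _ ≤ _ := ENNReal.rpow_le_rpow (enorm_sub_rotation_le hF hθ p) hq0
      _ ≤ _ := lintegral_rpow_le_measure_univ_mul _ hm.aemeasurable hq
      _ = _ := by simp [H]
  have hinner : ∀ s, ∫⁻ p in S, H (ContinuousLinearMap.rotation s p) ∂(γ.prod γ) =
      ∫⁻ p in S, H p ∂(γ.prod γ) := by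
    intro s
    rw [← (measurePreserving_rotation d s).setLIntegral_comp_preimage hS hH]
    congr 2
    ext p
    exact (hmemS s p).symm
  have hfin : ∫⁻ p in S, H p ∂(γ.prod γ) ≤ ENNReal.ofReal (gaussianAbsMoment q) *
      ∫⁻ x in Metric.closedBall 0 R, ‖G x‖ₑ ^ q ∂γ := by
    calc _ ≤ ∫⁻ p in Metric.closedBall 0 R ×ˢ Set.univ, H p ∂(γ.prod γ) := by
          refine lintegral_mono_set fun p hp => ⟨?_, trivial⟩
          rw [mem_closedBall_zero_iff]
          have : ‖p.1‖ ^ 2 + ‖p.2‖ ^ 2 ≤ R ^ 2 := hp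
          exact abs_le_of_sq_le_sq' (by nlinarith [sq_nonneg ‖p.2‖]) hR |>.2
      _ = ∫⁻ x in Metric.closedBall 0 R, ∫⁻ y, H (x, y) ∂γ ∂γ := by
          rw [← Measure.prod_restrict, Measure.restrict_univ, lintegral_prod _ hH.aemeasurable]
      _ = _ := by
          rw [← lintegral_const_mul' _ _ ENNReal.ofReal_ne_top]
          refine lintegral_congr fun x => ?_
          simp only [H, hG]
          exact lintegral_enorm_inner_rpow hq (G x)
  calc _ ≤ ∫⁻ p in S, (ENNReal.ofReal θ ^ (q - 1) *
        ∫⁻ s in Set.Ioc 0 θ, H (ContinuousLinearMap.rotation s p)) ∂(γ.prod γ) :=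
        lintegral_mono hpt
    _ = ENNReal.ofReal θ ^ (q - 1) * ∫⁻ s in Set.Ioc 0 θ,
        ∫⁻ p in S, H (ContinuousLinearMap.rotation s p) ∂(γ.prod γ) := by
        rw [lintegral_const_mul' _ _ (ENNReal.rpow_ne_top_of_nonneg (by linarith)
          ENNReal.ofReal_ne_top), lintegral_lintegral_swap]
        exact (hH.comp hrot).aemeasurable
    _ = ENNReal.ofReal θ ^ q * ∫⁻ p in S, H p ∂(γ.prod γ) := by
        simp_rw [hinner]
        rw [lintegral_const, Measure.restrict_apply_univ, Real.volume_Ioc, sub_zero, mul_comm _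
          (ENNReal.ofReal θ), ← mul_assoc]
        congr 1
        have := ENNReal.rpow_add_of_nonneg (x := ENNReal.ofReal θ) (q - 1) 1 (by linarith) zero_le_one
        rw [sub_add_cancel, ENNReal.rpow_one] at this
        exact this.symm
    _ ≤ _ := by
        grw [hfin]
        rw [mul_comm (gaussianAbsMoment q), ENNReal.ofReal_mul (by positivity),
          ENNReal.ofReal_rpow_of_nonneg hθ hq0, mul_assoc]

/-! ### Mollification of generalized gradients -/

open scoped Convolution

/-- Mollification commutes with the generalized gradient. -/
lemma HasGeneralizedGradient.fderiv_convolution {d : ℕ} {f : EuclideanSpace ℝ (Fin d) → ℝ}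
    {g : EuclideanSpace ℝ (Fin d) → EuclideanSpace ℝ (Fin d)} (h : HasGeneralizedGradient f g)
    {φ : EuclideanSpace ℝ (Fin d) → ℝ} (hφ : ContDiff ℝ ∞ φ) (hc : HasCompactSupport φ)
    (x v : EuclideanSpace ℝ (Fin d)) :
    fderiv ℝ (φ ⋆[ContinuousLinearMap.lsmul ℝ ℝ, volume] f) x v =
      inner ℝ ((φ ⋆[ContinuousLinearMap.lsmul ℝ ℝ, volume] g) x) v := by
  have hφ1 : ContDiff ℝ 1 φ := hφ.of_le (by simp)
  rw [(hc.hasFDerivAt_convolution_left _ hφ1 h.locallyIntegrable_fun x).fderiv]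
  have hg : Integrable (fun t => φ (x - t) • g t) :=
    (hc.convolutionExists_left (ContinuousLinearMap.lsmul ℝ ℝ) hφ.continuous
      h.locallyIntegrable_grad x).integrable_swap
  have hf := (hc.fderiv (𝕜 := ℝ).convolutionExists_left
    (ContinuousLinearMap.precompL (EuclideanSpace ℝ (Fin d)) (ContinuousLinearMap.lsmul ℝ ℝ))
    (hφ1.continuous_fderiv one_ne_zero) h.locallyIntegrable_fun x).integrable_swap
  rw [convolution_eq_swap, convolution_eq_swap, ContinuousLinearMap.integral_apply hf,
    real_inner_comm]
  simp only [ContinuousLinearMap.lsmul_apply]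
  rw [← integral_inner hg]
  have key := h.integral_by_parts (fun t => φ (x - t)) (hφ.comp (contDiff_const.sub contDiff_id))
    (hc.comp_homeomorph (Homeomorph.subLeft x)) v
  have hd : ∀ t, fderiv ℝ (fun t => φ (x - t)) t v = -fderiv ℝ φ (x - t) v := by
    intro t
    have h1 : HasFDerivAt (fun t => x - t)
        (-ContinuousLinearMap.id ℝ (EuclideanSpace ℝ (Fin d))) t := (hasFDerivAt_id t).const_sub x
    have h2 : HasFDerivAt (fun t => φ (x - t)) _ t :=
      (hφ1.differentiable one_ne_zero (x - t)).hasFDerivAt.comp t h1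
    rw [h2.fderiv]
    simp
  simp_rw [hd, mul_neg, integral_neg, neg_inj] at key
  calc _ = ∫ t, f t * fderiv ℝ φ (x - t) v := by
        refine integral_congr_ae (ae_of_all _ fun t => ?_)
        simp [mul_comm]
    _ = _ := by
        rw [key]
        refine integral_congr_ae (ae_of_all _ fun t => ?_)
        simp [inner_smul_right, real_inner_comm, mul_comm]

/-- Mollification with a normed bump function of small radius `r` increases the Gaussian `L^q` norm
on a ball of radius `R` by at most the factor `exp (r * (R + r))`: by Jensen's inequality this
reduces to translations of length at most `r`, whose densities the Cameron-Martin formula gives. -/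
lemma setLIntegral_enorm_convolution_rpow_le {d : ℕ} {q : ℝ} (hq : 1 ≤ q)
    {g : EuclideanSpace ℝ (Fin d) → EuclideanSpace ℝ (Fin d)} (hg : StronglyMeasurable g)
    (φ : ContDiffBump (0 : EuclideanSpace ℝ (Fin d))) (R : ℝ) :
    ∫⁻ x in Metric.closedBall 0 R,
        ‖(φ.normed volume ⋆[ContinuousLinearMap.lsmul ℝ ℝ, volume] g) x‖ₑ ^ q
          ∂(gaussianMeasure d) ≤
      ENNReal.ofReal (Real.exp (φ.rOut * (R + φ.rOut))) *
        ∫⁻ x, ‖g x‖ₑ ^ q ∂(gaussianMeasure d) := by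
  set γ := gaussianMeasure d
  have hq0 : 0 ≤ q := by linarith
  set ψ := φ.normed volume
  set ρ : EuclideanSpace ℝ (Fin d) → ℝ≥0∞ := fun z => ENNReal.ofReal (ψ z)
  have hρ : Measurable ρ := φ.continuous_normed.measurable.ennreal_ofReal
  have hρ1 : ∫⁻ z, ρ z = 1 := by
    rw [← ofReal_integral_eq_lintegral_ofReal φ.integrable_normed
      (ae_of_all _ φ.nonneg_normed), φ.integral_normed, ENNReal.ofReal_one]
  have hgm : Measurable fun x => ‖g x‖ₑ ^ q := hg.measurable.enorm.pow_const q
  have hpt : ∀ x, ‖(ψ ⋆[ContinuousLinearMap.lsmul ℝ ℝ, volume] g) x‖ₑ ^ q ≤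
      ∫⁻ z, ρ z * ‖g (x - z)‖ₑ ^ q := by
    intro x
    have hm : Measurable fun z => ‖g (x - z)‖ₑ := (hg.measurable.comp (by fun_prop)).enorm
    calc _ ≤ (∫⁻ z, ‖g (x - z)‖ₑ ∂(volume.withDensity ρ)) ^ q := by
          refine ENNReal.rpow_le_rpow ?_ hq0
          rw [convolution_def, lintegral_withDensity_eq_lintegral_mul _ hρ hm]
          refine (enorm_integral_le_lintegral_enorm _).trans (lintegral_mono fun z => ?_)
          simp only [ContinuousLinearMap.lsmul_apply, Pi.mul_apply, enorm_smul, ρ]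
          rw [Real.enorm_of_nonneg (φ.nonneg_normed z)]
      _ ≤ _ := lintegral_rpow_le_measure_univ_mul _ hm.aemeasurable hq
      _ = _ := by
          rw [withDensity_apply _ MeasurableSet.univ, setLIntegral_univ, hρ1, ENNReal.one_rpow,
            one_mul, lintegral_withDensity_eq_lintegral_mul _ hρ (hm.pow_const q)]
          rfl
  have htr : ∀ z ∈ Metric.ball (0 : EuclideanSpace ℝ (Fin d)) φ.rOut,
      ∫⁻ x in Metric.closedBall 0 R, ‖g (x - z)‖ₑ ^ q ∂γ ≤
      ENNReal.ofReal (Real.exp (φ.rOut * (R + φ.rOut))) * ∫⁻ x, ‖g x‖ₑ ^ q ∂γ := by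
    intro z hz
    rw [mem_ball_zero_iff] at hz
    set B : Set (EuclideanSpace ℝ (Fin d)) := Metric.closedBall 0 R
    have hB : MeasurableSet B := measurableSet_closedBall
    -- after the shift by `z` the ball indicator keeps the Cameron-Martin density bounded
    set k : EuclideanSpace ℝ (Fin d) → ℝ≥0∞ :=
      fun x => B.indicator 1 (x + z) * ‖g x‖ₑ ^ q
    have hk : Measurable k :=
      ((measurable_one.indicator hB).comp (measurable_add_const z)).mul hgm
    calc _ = ∫⁻ x, k (x + -z) ∂γ := by
          rw [← lintegral_indicator hB]
          refine lintegral_congr fun x => ?_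
          by_cases hx : x ∈ B <;> simp [k, hx, sub_eq_add_neg]
      _ = ∫⁻ x, k x ∂(γ.map (fun x => x + -z)) := by
          rw [lintegral_map hk (by fun_prop)]
      _ = ∫⁻ x, ENNReal.ofReal (Real.exp (inner ℝ (-z) x - ‖-z‖ ^ 2 / 2)) * k x ∂γ := by
          rw [gaussianMeasure_map_add_const, lintegral_withDensity_eq_lintegral_mul _
            (by fun_prop) hk]
          rfl
      _ ≤ ∫⁻ x, ENNReal.ofReal (Real.exp (φ.rOut * (R + φ.rOut))) * ‖g x‖ₑ ^ q ∂γ := by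
          refine lintegral_mono fun x => ?_
          by_cases hx : x + z ∈ B
          · have hx' : ‖x‖ ≤ R + φ.rOut := by
              rw [mem_closedBall_zero_iff] at hx
              calc ‖x‖ = ‖(x + z) - z‖ := by simp
                _ ≤ ‖x + z‖ + ‖z‖ := norm_sub_le _ _
                _ ≤ _ := by linarith
            simp only [k, hx, Set.indicator_of_mem, Pi.one_apply, one_mul]
            gcongr
            calc inner ℝ (-z) x - ‖-z‖ ^ 2 / 2 ≤ ‖-z‖ * ‖x‖ := by
                  linarith [real_inner_le_norm (-z) x, sq_nonneg ‖-z‖]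
              _ ≤ _ := by
                  rw [norm_neg]
                  exact mul_le_mul hz.le hx' (norm_nonneg x) φ.rOut_pos.le
          · simp [k, hx]
      _ = _ := lintegral_const_mul _ hgm
  calc _ ≤ ∫⁻ x in Metric.closedBall 0 R, (∫⁻ z, ρ z * ‖g (x - z)‖ₑ ^ q) ∂γ :=
        lintegral_mono hpt
    _ = ∫⁻ z, ρ z * (∫⁻ x in Metric.closedBall 0 R, ‖g (x - z)‖ₑ ^ q ∂γ) := by
        rw [lintegral_lintegral_swap]
        · refine lintegral_congr fun z => ?_
          rw [lintegral_const_mul' _ _ ENNReal.ofReal_ne_top]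
        · exact ((hρ.comp measurable_snd).mul
            (hgm.comp (measurable_fst.sub measurable_snd))).aemeasurable
    _ ≤ ∫⁻ z, ρ z * (ENNReal.ofReal (Real.exp (φ.rOut * (R + φ.rOut))) *
          ∫⁻ x, ‖g x‖ₑ ^ q ∂γ) := by
        refine lintegral_mono fun z => ?_
        by_cases hz : z ∈ Metric.ball (0 : EuclideanSpace ℝ (Fin d)) φ.rOut
        · exact mul_le_mul_right (htr z hz) _
        · have : ψ z = 0 := by
            by_contra hne
            exact hz (φ.support_normed_eq (μ := volume) ▸ hne)
          simp [ρ, this]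
    _ = _ := by rw [lintegral_mul_const _ hρ, hρ1, one_mul]

open Filter Topology
/-- For a function with generalized gradient `g`, the `L^q` norm of the increment between `x` and
`cos θ • x + sin θ • y`, for independent standard Gaussian `x` and `y`, is at most
`K_q * θ * ‖g‖_q`. The `C¹` case applied to mollifications passes to the limit by Fatou's lemma,
the radius of mollification tending to `0` before the ball exhausts the space. -/
theorem HasGeneralizedGradient.lintegral_enorm_sub_rotation_le {d : ℕ} {q : ℝ} (hq : 1 ≤ q)
    {f : EuclideanSpace ℝ (Fin d) → ℝ}
    {g : EuclideanSpace ℝ (Fin d) → EuclideanSpace ℝ (Fin d)} (h : HasGeneralizedGradient f g)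
    {θ : ℝ} (hθ : 0 ≤ θ) :
    ∫⁻ p, ‖f p.1 - f (ContinuousLinearMap.rotation θ p).1‖ₑ ^ q
        ∂((gaussianMeasure d).prod (gaussianMeasure d)) ≤
      ENNReal.ofReal (gaussianAbsMoment q * θ ^ q) * ∫⁻ x, ‖g x‖ₑ ^ q ∂(gaussianMeasure d) := by
  set γ := gaussianMeasure d
  set C := ENNReal.ofReal (gaussianAbsMoment q * θ ^ q) * ∫⁻ x, ‖g x‖ₑ ^ q ∂γ with hC
  have hac : γ ≪ (volume : Measure (EuclideanSpace ℝ (Fin d))) :=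
    gaussianMeasure_absolutelyContinuous d
  -- a measurable version of `g`, which has the same convolutions
  obtain ⟨g', hg', hgg'⟩ := h.locallyIntegrable_grad.aestronglyMeasurable
  have hCg' : ∫⁻ x, ‖g' x‖ₑ ^ q ∂γ = ∫⁻ x, ‖g x‖ₑ ^ q ∂γ :=
    lintegral_congr_ae (by filter_upwards [hac.ae_le hgg'] with x hx; rw [hx])
  -- a bounded ratio of the radii makes the mollifications converge almost everywhere
  let φ : ℕ → ContDiffBump (0 : EuclideanSpace ℝ (Fin d)) := fun n =>
    ⟨1 / ((n : ℝ) + 1), 2 * (1 / ((n : ℝ) + 1)), by positivity, by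
      have : 0 < 1 / ((n : ℝ) + 1) := by positivity
      linarith⟩
  have hr : Tendsto (fun n => (φ n).rOut) atTop (𝓝 0) := by
    have := (tendsto_one_div_add_atTop_nhds_zero_nat (𝕜 := ℝ)).const_mul 2
    rwa [mul_zero] at this
  set F : ℕ → EuclideanSpace ℝ (Fin d) → ℝ := fun n =>
    (φ n).normed volume ⋆[ContinuousLinearMap.lsmul ℝ ℝ, volume] f
  have hF : ∀ n, ContDiff ℝ 1 (F n) := fun n =>
    (φ n).hasCompactSupport_normed.contDiff_convolution_left _ (φ n).contDiff_normed
      h.locallyIntegrable_fun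
  have hlim : ∀ᵐ x ∂γ, Tendsto (fun n => F n x) atTop (𝓝 (f x)) := hac.ae_le <|
    ContDiffBump.ae_convolution_tendsto_right_of_locallyIntegrable (K := 2) hr
      (Eventually.of_forall fun n => le_rfl) h.locallyIntegrable_fun
  have hlim2 : ∀ᵐ p ∂(γ.prod γ), Tendsto
      (fun n => ‖F n p.1 - F n (ContinuousLinearMap.rotation θ p).1‖ₑ ^ q) atTop
      (𝓝 (‖f p.1 - f (ContinuousLinearMap.rotation θ p).1‖ₑ ^ q)) := by
    have h1 : ∀ᵐ p ∂(γ.prod γ), Tendsto (fun n => F n p.1) atTop (𝓝 (f p.1)) :=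
      Measure.quasiMeasurePreserving_fst.ae hlim
    filter_upwards [h1, (measurePreserving_rotation d θ).quasiMeasurePreserving.ae h1] with p hp hp'
    exact (ENNReal.continuous_rpow_const.tendsto _).comp (hp.sub hp').enorm
  have hball : ∀ R : ℕ, ∫⁻ p in {p | ‖p.1‖ ^ 2 + ‖p.2‖ ^ 2 ≤ (R : ℝ) ^ 2},
      ‖f p.1 - f (ContinuousLinearMap.rotation θ p).1‖ₑ ^ q ∂(γ.prod γ) ≤ C := by
    intro R
    have hn : ∀ n, ∫⁻ p in {p | ‖p.1‖ ^ 2 + ‖p.2‖ ^ 2 ≤ (R : ℝ) ^ 2},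
        ‖F n p.1 - F n (ContinuousLinearMap.rotation θ p).1‖ₑ ^ q ∂(γ.prod γ) ≤
        ENNReal.ofReal (Real.exp ((φ n).rOut * (R + (φ n).rOut))) * C := by
      intro n
      have hgrad : ∀ x v, fderiv ℝ (F n) x v = inner ℝ
          (((φ n).normed volume ⋆[ContinuousLinearMap.lsmul ℝ ℝ, volume] g') x) v := by
        intro x v
        rw [h.fderiv_convolution (φ n).contDiff_normed (φ n).hasCompactSupport_normed,
          convolution_congr (ContinuousLinearMap.lsmul ℝ ℝ) (ae_eq_refl _) hgg']
      refine (setLIntegral_enorm_sub_rotation_le hq (hF n) hgrad hθ (Nat.cast_nonneg R)).trans ?_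
      grw [setLIntegral_enorm_convolution_rpow_le hq hg' (φ n) R]
      rw [hCg', hC, mul_left_comm]
    have hexp : Tendsto (fun n => ENNReal.ofReal (Real.exp ((φ n).rOut * (R + (φ n).rOut))) * C)
        atTop (𝓝 C) := by
      have h1 : Tendsto (fun n => Real.exp ((φ n).rOut * (R + (φ n).rOut))) atTop (𝓝 1) := by
        have := (hr.mul (hr.const_add (R : ℝ))).rexp
        simpa using this
      have h2 := ENNReal.tendsto_ofReal h1
      rw [ENNReal.ofReal_one] at h2
      simpa using ENNReal.Tendsto.mul_const h2 (Or.inl one_ne_zero)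
    calc _ = ∫⁻ p in {p | ‖p.1‖ ^ 2 + ‖p.2‖ ^ 2 ≤ (R : ℝ) ^ 2}, liminf (fun n =>
          ‖F n p.1 - F n (ContinuousLinearMap.rotation θ p).1‖ₑ ^ q) atTop ∂(γ.prod γ) :=
          lintegral_congr_ae (ae_restrict_of_ae (hlim2.mono fun p hp => hp.liminf_eq.symm))
      _ ≤ _ := lintegral_liminf_le fun n => by
          have := (hF n).continuous
          have hm : Continuous fun p : EuclideanSpace ℝ (Fin d) × EuclideanSpace ℝ (Fin d) =>
            F n p.1 - F n (ContinuousLinearMap.rotation θ p).1 := by fun_prop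
          exact hm.measurable.enorm.pow_const q
      _ ≤ _ := liminf_le_liminf (Eventually.of_forall hn)
      _ = C := hexp.liminf_eq
  have hmono : Monotone fun R : ℕ => {p : EuclideanSpace ℝ (Fin d) × EuclideanSpace ℝ (Fin d) |
      ‖p.1‖ ^ 2 + ‖p.2‖ ^ 2 ≤ (R : ℝ) ^ 2} := by
    intro R R' hRR' p hp
    exact le_trans (b := (R : ℝ) ^ 2) hp (by gcongr)
  have hU : (⋃ R : ℕ, {p : EuclideanSpace ℝ (Fin d) × EuclideanSpace ℝ (Fin d) |
      ‖p.1‖ ^ 2 + ‖p.2‖ ^ 2 ≤ (R : ℝ) ^ 2}) = Set.univ := by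
    refine Set.eq_univ_of_forall fun p => Set.mem_iUnion.2 ?_
    obtain ⟨R, hR⟩ := exists_nat_ge (‖p.1‖ + ‖p.2‖)
    refine ⟨R, (?_ : ‖p.1‖ ^ 2 + ‖p.2‖ ^ 2 ≤ (R : ℝ) ^ 2)⟩
    nlinarith [norm_nonneg p.1, norm_nonneg p.2]
  rw [← setLIntegral_univ, ← hU, setLIntegral_iUnion_of_directed _ hmono.directed_le]
  exact iSup_le hball

/-! ### Entropy inequality and the Kantorovich distance -/

/-- Entropy inequality for a translation of the standard Gaussian measure: it is the duality
`∫ ψ dν ≤ Ent(ν | γ) - 1 + ∫ exp ψ dγ` for the translate `ν` of `γ` by `w` and `ψ` equal to `c` on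
`B` and to `0` elsewhere, the relative entropy of `ν` being `‖w‖² / 2`. -/
lemma mul_gaussianMeasure_preimage_add_const_le {d : ℕ} {B : Set (EuclideanSpace ℝ (Fin d))}
    (hB : MeasurableSet B) (w : EuclideanSpace ℝ (Fin d)) {c : ℝ} (hc : 0 ≤ c) :
    ENNReal.ofReal c * gaussianMeasure d ((fun z => z + w) ⁻¹' B) ≤
      ENNReal.ofReal (Real.exp c - 1) * gaussianMeasure d B + ENNReal.ofReal (‖w‖ ^ 2 / 2) := by
  set γ := gaussianMeasure d
  set ψ : EuclideanSpace ℝ (Fin d) → ℝ := B.indicator fun _ => c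
  have hψm : Measurable ψ := measurable_const.indicator hB
  have hψc : ∀ x, ψ x ≤ c := fun x => Set.indicator_le_self' (fun _ _ => hc) x
  have hB' : MeasurableSet ((fun z => z + w) ⁻¹' B) := (measurable_add_const w) hB
  have hexp : Integrable (fun z => Real.exp (inner ℝ (-w) z - ‖-w‖ ^ 2 / 2) *
      Real.exp (ψ (z + w))) γ := by
    refine (integrable_exp_inner (-w)).mul_bdd (c := Real.exp c)
      (Measurable.aestronglyMeasurable (by fun_prop)) (ae_of_all _ fun x => ?_)
    rw [Real.norm_of_nonneg (Real.exp_pos _).le]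
    exact Real.exp_le_exp.2 (hψc _)
  have h1 : ∫ z, ψ (z + w) ∂γ = c * γ.real ((fun z => z + w) ⁻¹' B) := by
    have : (fun z => ψ (z + w)) = ((fun z => z + w) ⁻¹' B).indicator fun _ => c := rfl
    rw [this, integral_indicator_const _ hB', smul_eq_mul, mul_comm]
  -- the first factor is the density of the translate of `γ` by `-w`, which undoes the shift in `ψ`
  have h2 : ∫ z, Real.exp (inner ℝ (-w) z - ‖-w‖ ^ 2 / 2) * Real.exp (ψ (z + w)) ∂γ =
      1 + (Real.exp c - 1) * γ.real B := by
    have e1 : ∫ x, Real.exp (ψ (x + w)) ∂(γ.map fun x => x + -w) = ∫ x, Real.exp (ψ x) ∂γ := by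
      rw [integral_map (by fun_prop) (Measurable.aestronglyMeasurable (by fun_prop))]
      simp
    have e2 : (fun x => Real.exp (ψ x)) = fun x => 1 + B.indicator (fun _ => Real.exp c - 1) x := by
      ext x
      by_cases hx : x ∈ B <;> simp [ψ, hx]
    rw [gaussianMeasure_map_add_const,
      integral_withDensity_eq_integral_toReal_smul (by fun_prop) (by simp)] at e1
    simp_rw [ENNReal.toReal_ofReal (Real.exp_pos _).le, smul_eq_mul] at e1
    rw [e1, e2, integral_add (integrable_const _) ((integrable_const _).indicator hB),
      integral_indicator_const _ hB]
    simp [mul_comm]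
  have h3 : ∫ z, inner ℝ w z ∂γ = 0 := integral_strongDual_stdGaussian (innerSL ℝ w)
  have hw : Integrable (fun z => inner ℝ w z) γ :=
    IsGaussian.integrable_dual γ (innerSL ℝ w)
  have hwc : Integrable (fun z => inner ℝ w z + (‖w‖ ^ 2 / 2 - 1)) γ :=
    hw.add (integrable_const _)
  have hreal : c * γ.real ((fun z => z + w) ⁻¹' B) ≤
      (Real.exp c - 1) * γ.real B + ‖w‖ ^ 2 / 2 := by
    have hle : ∫ z, ψ (z + w) ∂γ ≤ ∫ z, (inner ℝ w z + (‖w‖ ^ 2 / 2 - 1) +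
        Real.exp (inner ℝ (-w) z - ‖-w‖ ^ 2 / 2) * Real.exp (ψ (z + w))) ∂γ := by
      refine integral_mono ?_ (hwc.add hexp) fun z => ?_
      · exact (integrable_const c).indicator hB'
      · -- the convexity inequality `1 + s ≤ exp s`
        simp only [← Real.exp_add, inner_neg_left, norm_neg]
        linarith [Real.add_one_le_exp (-inner ℝ w z - ‖w‖ ^ 2 / 2 + ψ (z + w))]
    rw [integral_add hwc hexp, integral_add hw (integrable_const _), h1,
      h2, h3, integral_const] at hle
    simp at hle
    linarith
  have hexpc : 0 ≤ Real.exp c - 1 := by linarith [Real.add_one_le_exp c]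
  rw [← ofReal_measureReal, ← ofReal_measureReal, ← ENNReal.ofReal_mul hc,
    ← ENNReal.ofReal_mul hexpc, ← ENNReal.ofReal_add (by positivity) (by positivity)]
  exact ENNReal.ofReal_le_ofReal hreal

/-- Transition probabilities of the Ornstein-Uhlenbeck semigroup from two starting points `x` and
`y`, compared in the sense of the entropy inequality. -/
lemma mul_gaussianMeasure_rotation_le {d : ℕ} {A : Set (EuclideanSpace ℝ (Fin d))}
    (hA : MeasurableSet A) {θ : ℝ} (hθ : Real.sin θ ≠ 0) (x y : EuclideanSpace ℝ (Fin d))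
    {c : ℝ} (hc : 0 ≤ c) :
    ENNReal.ofReal c * gaussianMeasure d {z | (ContinuousLinearMap.rotation θ (x, z)).1 ∈ A} ≤
      ENNReal.ofReal (Real.exp c - 1) *
        gaussianMeasure d {z | (ContinuousLinearMap.rotation θ (y, z)).1 ∈ A} +
      ENNReal.ofReal (Real.cos θ ^ 2 / Real.sin θ ^ 2 / 2) * edist x y ^ (2 : ℝ) := by
  -- shifting the Gaussian variable by `w` moves the starting point from `y` to `x`
  set w := (Real.cos θ / Real.sin θ) • (x - y)
  have hB : MeasurableSet {z | (ContinuousLinearMap.rotation θ (y, z)).1 ∈ A} := by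
    have : Measurable fun z => (ContinuousLinearMap.rotation θ (y, z)).1 := by fun_prop
    exact this hA
  have hset : {z | (ContinuousLinearMap.rotation θ (x, z)).1 ∈ A} =
      (fun z => z + w) ⁻¹' {z | (ContinuousLinearMap.rotation θ (y, z)).1 ∈ A} := by
    ext z
    have : Real.cos θ • x + Real.sin θ • z = Real.cos θ • y + Real.sin θ • (z + w) := by
      simp only [w, smul_add, smul_smul, mul_div_cancel₀ _ hθ, smul_sub]
      abel
    simp [ContinuousLinearMap.rotation_apply, this]
  have hw : ENNReal.ofReal (‖w‖ ^ 2 / 2) =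
      ENNReal.ofReal (Real.cos θ ^ 2 / Real.sin θ ^ 2 / 2) * edist x y ^ (2 : ℝ) := by
    rw [edist_dist, dist_eq_norm, ENNReal.ofReal_rpow_of_nonneg (norm_nonneg _) zero_le_two,
      ← ENNReal.ofReal_mul (by positivity), norm_smul, Real.norm_eq_abs, mul_pow, sq_abs,
      Real.rpow_two]
    congr 1
    ring
  rw [hset, ← hw]
  exact mul_gaussianMeasure_preimage_add_const_le hB w hc

/-- Mehler's formula for the Ornstein-Uhlenbeck semigroup on functions with values in `[0, ∞]`, at
the time `t` with `exp (-t) = cos θ`. -/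
noncomputable def mehler {d : ℕ} (θ : ℝ) (φ : EuclideanSpace ℝ (Fin d) → ℝ≥0∞)
    (x : EuclideanSpace ℝ (Fin d)) : ℝ≥0∞ :=
  ∫⁻ y, φ (ContinuousLinearMap.rotation θ (x, y)).1 ∂(gaussianMeasure d)

lemma measurable_mehler {d : ℕ} (θ : ℝ) {φ : EuclideanSpace ℝ (Fin d) → ℝ≥0∞}
    (hφ : Measurable φ) : Measurable (mehler θ φ) := by
  have : Measurable fun p : EuclideanSpace ℝ (Fin d) × EuclideanSpace ℝ (Fin d) =>
    φ (ContinuousLinearMap.rotation θ p).1 := by fun_prop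
  exact this.lintegral_prod_right'

/-- The Ornstein-Uhlenbeck semigroup is symmetric with respect to `γ`. -/
lemma setLIntegral_mehler {d : ℕ} (θ : ℝ) {φ : EuclideanSpace ℝ (Fin d) → ℝ≥0∞}
    (hφ : Measurable φ) {A : Set (EuclideanSpace ℝ (Fin d))} (hA : MeasurableSet A) :
    ∫⁻ x in A, mehler θ φ x ∂(gaussianMeasure d) =
      ∫⁻ x, gaussianMeasure d {z | (ContinuousLinearMap.rotation (-θ) (x, z)).1 ∈ A}
        ∂((gaussianMeasure d).withDensity φ) := by
  set γ := gaussianMeasure d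
  have hrot : ∀ p : EuclideanSpace ℝ (Fin d) × EuclideanSpace ℝ (Fin d),
      (ContinuousLinearMap.rotation (-θ) (ContinuousLinearMap.rotation θ p)).1 = p.1 := by
    intro p
    simp only [ContinuousLinearMap.rotation_apply, Real.cos_neg, Real.sin_neg, smul_add, smul_smul]
    have := Real.sin_sq_add_cos_sq θ
    match_scalars
    · linear_combination this
    · ring
  have hA1 : Measurable (A.indicator (1 : EuclideanSpace ℝ (Fin d) → ℝ≥0∞)) :=
    measurable_one.indicator hA
  have hset : ∀ x, MeasurableSet {z | (ContinuousLinearMap.rotation (-θ) (x, z)).1 ∈ A} := by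
    intro x
    have : Measurable fun z => (ContinuousLinearMap.rotation (-θ) (x, z)).1 := by fun_prop
    exact this hA
  set K : EuclideanSpace ℝ (Fin d) × EuclideanSpace ℝ (Fin d) → ℝ≥0∞ := fun p =>
    φ p.1 * A.indicator 1 (ContinuousLinearMap.rotation (-θ) p).1
  have hK : Measurable K := by fun_prop
  have hl : ∫⁻ x in A, mehler θ φ x ∂γ =
      ∫⁻ p, K (ContinuousLinearMap.rotation θ p) ∂(γ.prod γ) := by
    have hKr : Measurable fun p => K (ContinuousLinearMap.rotation θ p) := by fun_prop
    rw [lintegral_prod _ hKr.aemeasurable, ← lintegral_indicator hA]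
    refine lintegral_congr fun x => ?_
    simp only [K, hrot]
    by_cases hx : x ∈ A <;> simp [hx, mehler, γ]
  have hr : ∫⁻ x, γ {z | (ContinuousLinearMap.rotation (-θ) (x, z)).1 ∈ A}
      ∂(γ.withDensity φ) = ∫⁻ p, K p ∂(γ.prod γ) := by
    have hm : Measurable fun x => γ {z | (ContinuousLinearMap.rotation (-θ) (x, z)).1 ∈ A} := by
      have : Measurable fun p : EuclideanSpace ℝ (Fin d) × EuclideanSpace ℝ (Fin d) =>
        (ContinuousLinearMap.rotation (-θ) p).1 := by fun_prop
      exact measurable_measure_prodMk_left (this hA)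
    rw [lintegral_prod _ hK.aemeasurable, lintegral_withDensity_eq_lintegral_mul _ hφ hm]
    refine lintegral_congr fun x => ?_
    simp only [Pi.mul_apply, K]
    have hAx : Measurable fun z => A.indicator (1 : EuclideanSpace ℝ (Fin d) → ℝ≥0∞)
      (ContinuousLinearMap.rotation (-θ) (x, z)).1 := by fun_prop
    rw [lintegral_const_mul _ hAx, ← lintegral_indicator_one (hset x)]
    rfl
  rw [hl, hr, (measurePreserving_rotation d θ).lintegral_comp hK]

lemma lintegral_gaussianMeasure_rotation {d : ℕ} (θ : ℝ) {A : Set (EuclideanSpace ℝ (Fin d))}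
    (hA : MeasurableSet A) :
    ∫⁻ x, gaussianMeasure d {z | (ContinuousLinearMap.rotation θ (x, z)).1 ∈ A}
      ∂(gaussianMeasure d) = gaussianMeasure d A := by
  have h := setLIntegral_mehler (d := d) (-θ) (φ := 1) measurable_one hA
  rw [withDensity_one, neg_neg] at h
  rw [← h]
  simp [mehler]

/-- Superlevel sets of the evolved density: the entropy inequality for the transition
probabilities, integrated over a coupling. The exponent `log u` is the optimal one. -/
lemma gaussianMeasure_le_mehler_le {d : ℕ} {θ : ℝ} (hθ : Real.sin θ ≠ 0) (hθ' : Real.cos θ ≠ 0)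
    {φ : EuclideanSpace ℝ (Fin d) → ℝ≥0∞} (hφ : Measurable φ) {u : ℝ} (hu : 1 ≤ u) :
    ENNReal.ofReal (u * Real.log u - u + 1) *
        gaussianMeasure d {x | ENNReal.ofReal u ≤ mehler θ φ x} ≤
      ENNReal.ofReal (Real.cos θ ^ 2 / Real.sin θ ^ 2 / 2) *
        kantorovichDist 2 ((gaussianMeasure d).withDensity φ) (gaussianMeasure d) ^ 2 := by
  have hu0 : 0 < u := by linarith
  have hlog : 0 ≤ Real.log u := Real.log_nonneg hu
  set γ := gaussianMeasure d
  set A := {x | ENNReal.ofReal u ≤ mehler θ φ x}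
  have hA : MeasurableSet A := measurableSet_le measurable_const (measurable_mehler θ hφ)
  set P : EuclideanSpace ℝ (Fin d) → ℝ≥0∞ :=
    fun x => γ {z | (ContinuousLinearMap.rotation (-θ) (x, z)).1 ∈ A}
  have hP : Measurable P := by
    have : Measurable fun p : EuclideanSpace ℝ (Fin d) × EuclideanSpace ℝ (Fin d) =>
      (ContinuousLinearMap.rotation (-θ) p).1 := by fun_prop
    exact measurable_measure_prodMk_left (this hA)
  have hlow : ENNReal.ofReal u * γ A ≤ ∫⁻ x, P x ∂(γ.withDensity φ) := by
    rw [← setLIntegral_mehler θ hφ hA, ← setLIntegral_const]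
    exact setLIntegral_mono (measurable_mehler θ hφ) fun x hx => hx
  have hκ : 0 < Real.cos θ ^ 2 / Real.sin θ ^ 2 / 2 := by positivity
  have hW : kantorovichDist 2 (γ.withDensity φ) γ ^ 2 = ⨅ σ ∈ couplings (γ.withDensity φ) γ,
      ∫⁻ z, edist z.1 z.2 ^ (2 : ℝ) ∂σ := by
    rw [kantorovichDist, ← ENNReal.rpow_mul_natCast, Nat.cast_ofNat, one_div_mul_cancel two_ne_zero,
      ENNReal.rpow_one]
  rw [hW]
  simp_rw [ENNReal.mul_iInf_of_ne (ENNReal.ofReal_pos.2 hκ).ne' ENNReal.ofReal_ne_top]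
  refine le_iInf₂ fun σ hσ => ?_
  have h1 : ∫⁻ z, P z.1 ∂σ = ∫⁻ x, P x ∂(γ.withDensity φ) := by
    rw [← hσ.1, lintegral_map hP measurable_fst]
  have h2 : ∫⁻ z, P z.2 ∂σ = γ A := by
    rw [← lintegral_map hP measurable_snd, hσ.2]
    exact lintegral_gaussianMeasure_rotation (-θ) hA
  have h3 : ENNReal.ofReal (Real.log u) * ∫⁻ z, P z.1 ∂σ ≤ ENNReal.ofReal (u - 1) *
      ∫⁻ z, P z.2 ∂σ + ENNReal.ofReal (Real.cos θ ^ 2 / Real.sin θ ^ 2 / 2) *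
        ∫⁻ z, edist z.1 z.2 ^ (2 : ℝ) ∂σ := by
    have hP1 : Measurable fun z : EuclideanSpace ℝ (Fin d) × EuclideanSpace ℝ (Fin d) => P z.1 :=
      hP.comp measurable_fst
    have hP2 : Measurable fun z : EuclideanSpace ℝ (Fin d) × EuclideanSpace ℝ (Fin d) => P z.2 :=
      hP.comp measurable_snd
    rw [← lintegral_const_mul _ hP1, ← lintegral_const_mul _ hP2,
      ← lintegral_const_mul _ (by fun_prop), ← lintegral_add_left (hP2.const_mul _)]
    refine lintegral_mono fun z => ?_
    have := mul_gaussianMeasure_rotation_le hA (θ := -θ) (by simpa using hθ) z.1 z.2 hlog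
    rwa [Real.exp_log hu0, Real.cos_neg, Real.sin_neg, neg_sq] at this
  rw [h1, h2] at h3
  -- `u * log u` splits as `(u - 1) + (u * log u - u + 1)`, and the first part cancels
  have h4 : ENNReal.ofReal (u - 1) * γ A + ENNReal.ofReal (u * Real.log u - u + 1) * γ A ≤
      ENNReal.ofReal (u - 1) * γ A + ENNReal.ofReal (Real.cos θ ^ 2 / Real.sin θ ^ 2 / 2) *
        ∫⁻ z, edist z.1 z.2 ^ (2 : ℝ) ∂σ := by
    refine le_trans (le_of_eq ?_) ((mul_le_mul_right hlow (ENNReal.ofReal (Real.log u))).trans h3)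
    have hpos : 0 ≤ u * Real.log u - u + 1 := by
      have := Real.one_sub_inv_le_log_of_pos hu0
      have h5 : u * (1 - u⁻¹) = u - 1 := by field_simp
      nlinarith
    rw [← add_mul, ← mul_assoc, ← ENNReal.ofReal_add (by linarith) hpos, ← ENNReal.ofReal_mul hlog]
    congr 2
    ring
  exact (ENNReal.add_le_add_iff_left
    (ENNReal.mul_ne_top ENNReal.ofReal_ne_top (measure_ne_top _ _))).1 h4

/-! ### Superlevel sets of a Sobolev density -/

/-- A function that is at least `2 * u` at `x` either differs much from its values at the points
`cos θ • x + sin θ • y`, in the mean over `y`, or has a large mean over these points. -/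
lemma gaussianMeasure_two_mul_le_le_add {d : ℕ} {q : ℝ} (hq : 1 ≤ q)
    {f : EuclideanSpace ℝ (Fin d) → ℝ} (hf : Measurable f) {u : ℝ} (hu : 0 ≤ u) (θ : ℝ) :
    gaussianMeasure d {x | 2 * u ≤ f x} ≤
      gaussianMeasure d {x | ENNReal.ofReal u ^ q ≤
        ∫⁻ y, ‖f x - f (ContinuousLinearMap.rotation θ (x, y)).1‖ₑ ^ q ∂(gaussianMeasure d)} +
      gaussianMeasure d {x | ENNReal.ofReal u ≤ mehler θ (fun z => ENNReal.ofReal (f z)) x} := by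
  refine (measure_mono fun x hx => ?_).trans (measure_union_le _ _)
  replace hx : 2 * u ≤ f x := hx
  set γ := gaussianMeasure d
  by_cases hm : ENNReal.ofReal u ≤ mehler θ (fun z => ENNReal.ofReal (f z)) x
  · exact Or.inr hm
  refine Or.inl ?_
  have hmeas : Measurable fun y => ‖f x - f (ContinuousLinearMap.rotation θ (x, y)).1‖ₑ := by
    fun_prop
  have hle : ENNReal.ofReal (f x) ≤ mehler θ (fun z => ENNReal.ofReal (f z)) x +
      ∫⁻ y, ‖f x - f (ContinuousLinearMap.rotation θ (x, y)).1‖ₑ ∂γ := by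
    rw [mehler, ← lintegral_add_right _ hmeas]
    calc _ = ∫⁻ _, ENNReal.ofReal (f x) ∂γ := by simp
      _ ≤ _ := lintegral_mono fun y => by
        set b := f (ContinuousLinearMap.rotation θ (x, y)).1
        calc ENNReal.ofReal (f x) ≤ ENNReal.ofReal (b + ‖f x - b‖) :=
              ENNReal.ofReal_le_ofReal (by linarith [Real.le_norm_self (f x - b)])
          _ ≤ _ := by
              rw [← ofReal_norm]
              exact ENNReal.ofReal_add_le
  have hu1 : ENNReal.ofReal u ≤
      ∫⁻ y, ‖f x - f (ContinuousLinearMap.rotation θ (x, y)).1‖ₑ ∂γ := by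
    by_contra hlt
    have h2 : ENNReal.ofReal u + ENNReal.ofReal u ≤ ENNReal.ofReal (f x) := by
      rw [← ENNReal.ofReal_add hu hu]
      exact ENNReal.ofReal_le_ofReal (by linarith)
    exact absurd (h2.trans hle)
      (not_le.2 (ENNReal.add_lt_add (not_le.1 hm) (not_le.1 hlt)))
  have hJ := lintegral_rpow_le_measure_univ_mul γ hmeas.aemeasurable hq
  rw [measure_univ, ENNReal.one_rpow, one_mul] at hJ
  exact (ENNReal.rpow_le_rpow hu1 (by linarith)).trans hJ

theorem mainTheorem7 (d : ℕ) (q : ℝ) (hq : 1 ≤ q)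
    (f : EuclideanSpace ℝ (Fin d) → ℝ)
    (g : EuclideanSpace ℝ (Fin d) → EuclideanSpace ℝ (Fin d))
    (hf : MemGaussianSobolev q f)
    (hfg : HasGeneralizedGradient f g)
    (hf_nonneg : ∀ᵐ x ∂(gaussianMeasure d), 0 ≤ f x)
    (hf_int : ∫ x, f x ∂(gaussianMeasure d) = 1)
    (u : ℝ) (hu : 8 ≤ u) :
    gaussianMeasure d {x | 2 * u ≤ f x} ≤
      ⨅ t : Set.Ioi (0 : ℝ),
        (ENNReal.ofReal
            (gaussianAbsMoment q * Real.arccos (Real.exp (-(t : ℝ))) ^ q / u ^ q) *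
            eLpNorm g (ENNReal.ofReal q) (gaussianMeasure d) ^ q +
          ENNReal.ofReal (2 / ((Real.exp (2 * (t : ℝ)) - 1) * u * Real.log u)) *
            kantorovichDist 2 (gaussianWithDensity f) (gaussianMeasure d) ^ 2) := by
  refine le_iInf fun ⟨t, ht⟩ => ?_
  replace ht : 0 < t := ht
  simp only []
  have hq0 : 0 < q := by linarith
  have hu0 : 0 < u := by linarith
  set γ := gaussianMeasure d
  set θ := Real.arccos (Real.exp (-t))
  have hcos : Real.cos θ = Real.exp (-t) :=
    Real.cos_arccos (by linarith [Real.exp_pos (-t)]) (Real.exp_le_one_iff.2 (by linarith))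
  have hsin : Real.sin θ ^ 2 = 1 - Real.exp (-t) ^ 2 := by
    rw [Real.sin_sq, hcos]
  have hexp : Real.exp (-t) ^ 2 * Real.exp (2 * t) = 1 := by
    rw [← Real.exp_nat_mul, ← Real.exp_add]
    simp
  have hexp1 : 1 < Real.exp (2 * t) := Real.one_lt_exp_iff.2 (by linarith)
  have hsin0 : Real.sin θ ≠ 0 := by
    intro h0
    rw [h0] at hsin
    nlinarith
  -- a Borel version of the density
  obtain ⟨f₀, hf₀, hff₀⟩ := hf.1.aestronglyMeasurable
  replace hf₀ : Measurable f₀ := hf₀.measurable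
  set φ : EuclideanSpace ℝ (Fin d) → ℝ≥0∞ := fun x => ENNReal.ofReal (f₀ x)
  have hφ : Measurable φ := hf₀.ennreal_ofReal
  have hdens : gaussianWithDensity f = γ.withDensity φ :=
    withDensity_congr_ae (by filter_upwards [hff₀] with x hx; simp [φ, hx])
  set K : EuclideanSpace ℝ (Fin d) × EuclideanSpace ℝ (Fin d) → ℝ≥0∞ :=
    fun p => ‖f₀ p.1 - f₀ (ContinuousLinearMap.rotation θ p).1‖ₑ
  have hK : Measurable K := by fun_prop
  have hKint : ∫⁻ p, K p ^ q ∂(γ.prod γ) ≤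
      ENNReal.ofReal (gaussianAbsMoment q * θ ^ q) * ∫⁻ x, ‖g x‖ₑ ^ q ∂γ := by
    refine le_trans (le_of_eq ?_) (hfg.lintegral_enorm_sub_rotation_le hq (Real.arccos_nonneg _))
    have h1 : ∀ᵐ p ∂(γ.prod γ), f p.1 = f₀ p.1 := Measure.quasiMeasurePreserving_fst.ae hff₀
    refine lintegral_congr_ae ?_
    filter_upwards [h1, (measurePreserving_rotation d θ).quasiMeasurePreserving.ae h1] with p hp hp'
    simp only [K, hp, hp']
  have hsplit : γ {x | 2 * u ≤ f x} ≤
      γ {x | ENNReal.ofReal u ^ q ≤ ∫⁻ y, K (x, y) ^ q ∂γ} +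
        γ {x | ENNReal.ofReal u ≤ mehler θ φ x} := by
    refine (measure_mono_ae ?_).trans (gaussianMeasure_two_mul_le_le_add hq hf₀ hu0.le θ)
    filter_upwards [hff₀] with x hx hfx
    exact (show 2 * u ≤ f₀ x from hx ▸ hfx)
  refine hsplit.trans (add_le_add ?_ ?_)
  · have hm := mul_meas_ge_le_lintegral (μ := γ)
      ((hK.pow_const q).lintegral_prod_right' (ν := γ)) (ENNReal.ofReal u ^ q)
    rw [← lintegral_prod _ (hK.pow_const q).aemeasurable] at hm
    have hg : eLpNorm g (ENNReal.ofReal q) γ ^ q = ∫⁻ x, ‖g x‖ₑ ^ q ∂γ := by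
      rw [eLpNorm_eq_lintegral_rpow_enorm_toReal (by simpa using hq0) ENNReal.ofReal_ne_top,
        ENNReal.toReal_ofReal hq0.le, ← ENNReal.rpow_mul, one_div_mul_cancel hq0.ne',
        ENNReal.rpow_one]
    have huq : ENNReal.ofReal (u ^ q) = ENNReal.ofReal u ^ q :=
      (ENNReal.ofReal_rpow_of_nonneg hu0.le hq0.le).symm
    rw [hg, ENNReal.ofReal_div_of_pos (by positivity), huq, ENNReal.mul_div_right_comm.symm,
      ENNReal.le_div_iff_mul_le (Or.inl ?_) (Or.inl ?_), mul_comm]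
    · exact hm.trans hKint
    · rw [← huq]
      exact (ENNReal.ofReal_pos.2 (by positivity)).ne'
    · rw [← huq]
      exact ENNReal.ofReal_ne_top
  · have hm := gaussianMeasure_le_mehler_le hsin0 (by rw [hcos]; positivity) hφ
      (show 1 ≤ u by linarith)
    have hlog : 2 ≤ Real.log u := by
      rw [Real.le_log_iff_exp_le hu0]
      have : Real.exp 2 = Real.exp 1 ^ 2 := by rw [← Real.exp_nat_mul]; simp
      nlinarith [Real.exp_one_lt_d9, Real.exp_pos 1]
    have hul : 0 < u * Real.log u := by positivity
    have hκ : Real.cos θ ^ 2 / Real.sin θ ^ 2 / 2 = 1 / (2 * (Real.exp (2 * t) - 1)) := by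
      have h1 : Real.sin θ ^ 2 ≠ 0 := by positivity
      have h2 : Real.exp (2 * t) - 1 ≠ 0 := by linarith
      rw [hcos, div_div, div_eq_div_iff (by positivity) (by simpa using h2), hsin]
      linear_combination 2 * hexp
    rw [hκ, ← hdens] at hm
    have hE : 0 < Real.exp (2 * t) - 1 := by linarith
    set b := u * Real.log u - u + 1
    -- `b` is at least half of `u * log u`, because `2 ≤ log u`
    have hb : u * Real.log u / 2 ≤ b := by nlinarith
    have hb0 : 0 < b := by linarith
    have hcoef : b⁻¹ * (1 / (2 * (Real.exp (2 * t) - 1))) ≤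
        2 / ((Real.exp (2 * t) - 1) * u * Real.log u) := by
      calc _ ≤ (u * Real.log u / 2)⁻¹ * (1 / (Real.exp (2 * t) - 1)) := by
            gcongr
            linarith
        _ = _ := by field_simp
    calc γ {x | ENNReal.ofReal u ≤ mehler θ φ x}
        = ENNReal.ofReal b⁻¹ *
            (ENNReal.ofReal b * γ {x | ENNReal.ofReal u ≤ mehler θ φ x}) := by
          rw [← mul_assoc, ← ENNReal.ofReal_mul (by positivity), inv_mul_cancel₀ hb0.ne',
            ENNReal.ofReal_one, one_mul]
      _ ≤ ENNReal.ofReal b⁻¹ * (ENNReal.ofReal (1 / (2 * (Real.exp (2 * t) - 1))) *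
            kantorovichDist 2 (gaussianWithDensity f) γ ^ 2) := mul_le_mul_right hm _
      _ ≤ _ := by
          rw [← mul_assoc, ← ENNReal.ofReal_mul (by positivity)]
          gcongr
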